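/- Let $L>2$ be a prime, let $\Delta$ be the graph Laplacian of the cycle $\mathbb{Z}/L\mathbb{Z}$, i.e. $(\Delta\psi)(j)=2\psi(j)-\psi(j+1)-\psi(j-1)$, let $v:\mathbb{Z}/L\mathbb{Z}\to\{1,-1\}$, put $V=\mathrm{diag}(v)$ and $H_t=\Delta+tV$ for $t\in\mathbb{R}$. Say that a real symmetric matrix is degenerate if some eigenvalue is not simple, and that it has a vanishing eigenvector if some eigenvector has a zero entry. Call $V$ bad if, for every $t\in\mathbb{R}$, $H_t$ is degenerate or has a vanishing eigenvector. Then $V$ is bad if and only if $v$ has a reflection symmetry about some vertex, i.e. there is $j\in\mathbb{Z}/L\mathbb{Z}$ with $v(j+i)=v(j-i)$ for all $i\in\mathbb{Z}/L\mathbb{Z}$. In particular: 1. If $H_t$ is degenerate for all $t\in\mathbb{R}$, then $V=I$ or $V=-I$. 2. If $H_t$ has a vanishing eigenvector for all $t\in\mathbb{R}$, then $v$ has a reflection symmetry about some vertex. -/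

import Mathlib

/-- Every eigenvalue of the real matrix `A` has a one-dimensional eigenspace.  For the real
symmetric matrices considered below this says that the spectrum is nondegenerate. -/
def HasSimpleEigenvalues {n : Type*} [Fintype n] [DecidableEq n] (A : Matrix n n ℝ) : Prop :=
  ∀ μ : ℝ, Module.End.HasEigenvalue (Matrix.toLin' A) μ →
    Module.finrank ℝ (Module.End.eigenspace (Matrix.toLin' A) μ) = 1

/-- All entries of all eigenvectors of `A` are nonzero. -/
def HasNonvanishingEigenvectors {n : Type*} [Fintype n] [DecidableEq n]
    (A : Matrix n n ℝ) : Prop :=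
  ∀ (μ : ℝ) (φ : n → ℝ), Module.End.HasEigenvector (Matrix.toLin' A) μ φ → ∀ i, φ i ≠ 0

/-- The cycle on `ℤ/Lℤ` (for `L > 2`): `j` and `k` are adjacent iff they differ by one. -/
abbrev cycleOn (L : ℕ) : SimpleGraph (ZMod L) :=
  SimpleGraph.circulantGraph {1}

/-- The Hamiltonian `H_t = Δ + t V` on the cycle `ℤ/Lℤ`, with `Δ` the graph Laplacian
(degree matrix minus adjacency matrix) and `V = diag(v)`. -/
noncomputable def hamiltonian (L : ℕ) [NeZero L] (v : ZMod L → ℝ) (t : ℝ) :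
    Matrix (ZMod L) (ZMod L) ℝ :=
  (cycleOn L).lapMatrix ℝ + t • Matrix.diagonal v

/-- The potential `diag(v)` is bad: for every real `t`, the Hamiltonian `H_t` fails to have simple
eigenvalues or fails to have non-vanishing eigenvectors. -/
def IsBadPotential (L : ℕ) [NeZero L] (v : ZMod L → ℝ) : Prop :=
  ∀ t : ℝ, ¬ (HasSimpleEigenvalues (hamiltonian L v t) ∧
    HasNonvanishingEigenvectors (hamiltonian L v t))

/-- `v` is symmetric under the reflection of the cycle `ℤ/Lℤ` about some vertex `j`. -/
def HasReflectionSymmetry (L : ℕ) (v : ZMod L → ℝ) : Prop :=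
  ∃ j : ZMod L, ∀ i : ZMod L, v (j + i) = v (j - i)

/-! If `v` is symmetric about `j`, the reflection `R` commutes with `H_t`, so `R φ - φ` is zero or
an eigenvector vanishing at `j`; the eigenvectors span, so they cannot all be even. Conversely, let
`V` be bad. Degeneracy also yields an eigenvector vanishing at any given vertex, so by finiteness
some `j` works for arbitrarily small `t ≠ 0`. As `t → 0`, `exists_limit_eigenvector` gives a sine
wave `φ` about `j` with `V φ` orthogonal to its companion cosine. This reads `∑ v (j + i) (z^(2i) -
z^(-2i)) = 0` for a primitive `L`-th root of unity `z`; as `v` is rational and `L` an odd prime, `v`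
is even about `j` (`even_of_sum_mul_eq_zero`). -/

open Filter Topology Polynomial

/-! ### The Hamiltonian as a recurrence; vanishing eigenvectors -/

section Hamiltonian

variable {L : ℕ} [Fact L.Prime]

lemma cycleOn_neighborFinset (i : ZMod L) :
    (cycleOn L).neighborFinset i = {i + 1, i - 1} := by
  ext k
  have h1 : (1 : ZMod L) ≠ 0 := one_ne_zero
  simp only [SimpleGraph.mem_neighborFinset, SimpleGraph.circulantGraph_adj,
    Set.mem_singleton_iff, Finset.mem_insert, Finset.mem_singleton]
  constructor
  · rintro ⟨-, h | h⟩
    · right; rw [← h]; ring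
    · left; rw [← h]; ring
  · rintro (rfl | rfl)
    · exact ⟨fun h => h1 (by linear_combination -h), Or.inr (by ring)⟩
    · exact ⟨fun h => h1 (by linear_combination h), Or.inl (by ring)⟩

lemma ZMod.two_ne_zero_of_two_lt (hL : 2 < L) : (2 : ZMod L) ≠ 0 := by
  have h : ((2 : ℕ) : ZMod L) ≠ 0 := by
    rw [Ne, ZMod.natCast_eq_zero_iff]
    exact Nat.not_dvd_of_pos_of_lt two_pos hL
  exact_mod_cast h

lemma hamiltonian_mulVec_apply (hL : 2 < L) (v : ZMod L → ℝ) (t : ℝ) (φ : ZMod L → ℝ)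
    (i : ZMod L) :
    (hamiltonian L v t).mulVec φ i =
      2 * φ i - φ (i + 1) - φ (i - 1) + t * (v i * φ i) := by
  have hne : i + 1 ≠ i - 1 := by
    intro h
    apply ZMod.two_ne_zero_of_two_lt hL
    linear_combination h
  rw [hamiltonian, Matrix.add_mulVec, Pi.add_apply, SimpleGraph.lapMatrix_mulVec_apply,
    Matrix.smul_mulVec, ← SimpleGraph.card_neighborFinset_eq_degree, cycleOn_neighborFinset,
    Finset.card_pair hne, Finset.sum_pair hne]
  simp [Matrix.mulVec_diagonal]
  ring

lemma hasEigenvector_hamiltonian_iff (hL : 2 < L) (v : ZMod L → ℝ) (t μ : ℝ)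
    (φ : ZMod L → ℝ) :
    Module.End.HasEigenvector (Matrix.toLin' (hamiltonian L v t)) μ φ ↔
      φ ≠ 0 ∧ ∀ i, 2 * φ i - φ (i + 1) - φ (i - 1) + t * (v i * φ i) = μ * φ i := by
  rw [Module.End.hasEigenvector_iff, Module.End.mem_eigenspace_iff, and_comm, Matrix.toLin'_apply,
    funext_iff]
  simp only [hamiltonian_mulVec_apply hL, Pi.smul_apply, smul_eq_mul]

/-- Some eigenvector of `A` vanishes at `j`. -/
def HasEigenvectorVanishingAt {n : Type*} [Fintype n] [DecidableEq n] (A : Matrix n n ℝ)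
    (j : n) : Prop :=
  ∃ (μ : ℝ) (φ : n → ℝ), Module.End.HasEigenvector (Matrix.toLin' A) μ φ ∧ φ j = 0

/-- A two-dimensional eigenspace contains eigenvectors vanishing at any prescribed index. -/
lemma HasEigenvectorVanishingAt.of_not_hasSimpleEigenvalues {n : Type*} [Fintype n]
    [DecidableEq n] {A : Matrix n n ℝ} (h : ¬ HasSimpleEigenvalues A) (j : n) :
    HasEigenvectorVanishingAt A j := by
  simp only [HasSimpleEigenvalues, not_forall] at h
  obtain ⟨μ, hμ, hne⟩ := h
  set E := Module.End.eigenspace (Matrix.toLin' A) μ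
  let ev : E →ₗ[ℝ] ℝ := (LinearMap.proj j).comp E.subtype
  have hpos : 0 < Module.finrank ℝ E := by
    rw [Module.finrank_pos_iff, Submodule.nontrivial_iff_ne_bot]
    exact hμ
  have hker : LinearMap.ker ev ≠ ⊥ := by
    apply LinearMap.ker_ne_bot_of_finrank_lt
    rw [Module.finrank_self]
    omega
  obtain ⟨⟨φ, hφ⟩, hφker, hφ0⟩ := Submodule.exists_mem_ne_zero_of_ne_bot hker
  exact ⟨μ, φ, ⟨hφ, fun h => hφ0 (Subtype.ext h)⟩, hφker⟩

end Hamiltonian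

/-! ### Rational relations between roots of unity -/

section Cyclotomic

/-- Among the powers `1, z, …, z ^ (p - 1)` of a primitive `p`-th root of unity, all but the first
are linearly independent over `ℚ`. -/
lemma IsPrimitiveRoot.eq_zero_of_sum_eq_zero {p : ℕ} [Fact p.Prime] {z : ℂ}
    (hz : IsPrimitiveRoot z p) (w : ZMod p → ℚ) (h0 : w 0 = 0)
    (h : ∑ i : ZMod p, (w i : ℂ) * z ^ i.val = 0) : w = 0 := by
  have hp : 0 < p := (Fact.out : p.Prime).pos
  set P : ℚ[X] := ∑ i : ZMod p, C (w i) * X ^ i.val with hP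
  have hcoeff : ∀ i : ZMod p, P.coeff i.val = w i := by
    intro i
    simp only [hP, finsetSum_coeff, coeff_C_mul, coeff_X_pow]
    rw [Finset.sum_eq_single i]
    · simp
    · intro k _ hk
      rw [if_neg fun h => hk (ZMod.val_injective p h.symm), mul_zero]
    · simp
  have hroot : aeval z P = 0 := by
    simpa [hP] using h
  obtain ⟨R, hR⟩ : cyclotomic p ℚ ∣ P := by
    rw [cyclotomic_eq_minpoly_rat hz hp]
    exact minpoly.dvd ℚ z hroot
  have hdeg : P.natDegree ≤ p - 1 := by
    refine natDegree_sum_le_of_forall_le _ _ fun i _ => ?_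
    exact (natDegree_C_mul_X_pow_le _ _).trans (Nat.le_pred_of_lt (ZMod.val_lt i))
  -- By degree, `P` is a constant multiple of the cyclotomic polynomial, whose constant term is 1,
  -- while that of `P` is `w 0 = 0`.
  have hP0 : P = 0 := by
    by_contra hne
    have hR0 : R ≠ 0 := by rintro rfl; simp at hR; exact hne hR
    have hd := natDegree_mul (cyclotomic_ne_zero p ℚ) hR0
    rw [← hR, natDegree_cyclotomic, Nat.totient_prime Fact.out] at hd
    have hR1 : R.natDegree = 0 := by omega
    have hc : P.coeff 0 = 0 := by
      have := hcoeff 0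
      rwa [ZMod.val_zero, h0] at this
    rw [hR, mul_coeff_zero, cyclotomic_coeff_zero ℚ (Fact.out : p.Prime).one_lt, one_mul] at hc
    apply hR0
    rw [eq_C_of_natDegree_eq_zero hR1, hc, C_0]
  funext i
  rw [← hcoeff i, hP0, coeff_zero, Pi.zero_apply]

end Cyclotomic

/-! ### Eigenvectors of the free Laplacian -/

section FreeEigenvectors

variable {L : ℕ} [Fact L.Prime]

lemma ZMod.apply_eq_pow_mul {f : ZMod L → ℂ} {z : ℂ} (h : ∀ i, f (i + 1) = z * f i)
    (n : ℕ) : f n = z ^ n * f 0 := by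
  induction n with
  | zero => simp
  | succ n ih => rw [Nat.cast_succ, h, ih]; ring

/-- A solution of the recurrence `φ (i + 1) + φ (i - 1) = c φ i` on the cycle with initial values
`0, 0` is zero. -/
lemma eq_zero_of_cycle_recurrence {φ : ZMod L → ℝ} {c : ℝ}
    (hrec : ∀ i, φ (i + 1) + φ (i - 1) = c * φ i) (h0 : φ 0 = 0) (h1 : φ 1 = 0) : φ = 0 := by
  have key : ∀ n : ℕ, φ n = 0 ∧ φ (n + 1) = 0 := by
    intro n
    induction n with
    | zero => simpa using ⟨h0, h1⟩
    | succ n ih =>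
      have := hrec (n + 1)
      rw [ih.2, add_sub_cancel_right, ih.1] at this
      push_cast
      exact ⟨ih.2, by linarith⟩
  funext i
  rw [← ZMod.natCast_zmod_val i]
  exact (key _).1

/-- Nonzero solutions of `φ (i + 1) + φ (i - 1) = c φ i` on the cycle vanishing at `0` are, up to a
scalar, `z ^ i - z ^ (-i)` with `z` a primitive `L`-th root of unity. -/
lemma exists_primitiveRoot_of_cycle_recurrence {φ : ZMod L → ℝ} {c : ℝ}
    (hrec : ∀ i, φ (i + 1) + φ (i - 1) = c * φ i) (h0 : φ 0 = 0) (h1 : φ 1 ≠ 0) :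
    ∃ z : ℂ, IsPrimitiveRoot z L ∧ ∀ i : ZMod L,
      (z - z⁻¹) * φ i = φ 1 * (z ^ i.val - z⁻¹ ^ i.val) ∧
      (φ (i + 1) - φ (i - 1) : ℂ) = φ 1 * (z ^ i.val + z⁻¹ ^ i.val) := by
  obtain ⟨z, hz⟩ : ∃ z : ℂ, z * z - c * z + 1 = 0 := by
    obtain ⟨z, hz⟩ := IsAlgClosed.exists_root (X ^ 2 - C (c : ℂ) * X + 1 : ℂ[X]) (by
      have : (X ^ 2 - C (c : ℂ) * X + 1 : ℂ[X]).degree = 2 := by compute_degree!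
      rw [this]; norm_num)
    refine ⟨z, ?_⟩
    simp [IsRoot] at hz
    linear_combination hz
  have hz0 : z ≠ 0 := by rintro rfl; simp at hz
  have hc : (c : ℂ) = z + z⁻¹ := by field_simp; linear_combination -hz
  have hrec' : ∀ i, (φ (i + 1) + φ (i - 1) : ℂ) = (z + z⁻¹) * φ i := by
    intro i; rw [← hc]; exact_mod_cast hrec i
  -- The recurrence factors: `φ (i + 1) - b φ i` is geometric with ratio `a`.
  have step : ∀ a b : ℂ, a + b = z + z⁻¹ → a * b = 1 → ∀ n : ℕ,
      (φ (n + 1) - b * φ n : ℂ) = a ^ n * φ 1 := by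
    intro a b hab hab1 n
    have := ZMod.apply_eq_pow_mul (L := L) (f := fun i => (φ (i + 1) - b * φ i : ℂ)) (z := a) ?_ n
    · simpa [h0] using this
    · intro i
      have h := hrec' (i + 1)
      rw [add_sub_cancel_right, ← hab] at h
      linear_combination h + (φ i : ℂ) * hab1
  have s1 := step z z⁻¹ rfl (mul_inv_cancel₀ hz0)
  have s2 := step z⁻¹ z (add_comm _ _) (inv_mul_cancel₀ hz0)
  have h1' : (φ 1 : ℂ) ≠ 0 := by exact_mod_cast h1
  have hzL : z ^ L = 1 := by
    have := s1 L
    rw [ZMod.natCast_self, zero_add, h0] at this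
    apply mul_right_cancel₀ h1'
    rw [← this]; simp
  -- For `z = 1` the solution would be linear, hence not periodic.
  have hz1 : z ≠ 1 := by
    rintro rfl
    have hs : ∀ n : ℕ, (φ n : ℂ) = n * φ 1 := by
      intro n
      induction n with
      | zero => simp [h0]
      | succ n ih =>
        have := s1 n
        push_cast
        simp only [inv_one, one_mul, one_pow] at this
        linear_combination this + ih
    have := hs L
    rw [ZMod.natCast_self, h0] at this
    have hL0 : (L : ℂ) ≠ 0 := by exact_mod_cast (Fact.out : L.Prime).ne_zero
    simp [hL0, h1] at this
  refine ⟨z, ?_, fun i => ?_⟩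
  · rw [← orderOf_eq_prime hzL hz1]
    exact IsPrimitiveRoot.orderOf z
  · have e1 := s1 i.val
    have e2 := s2 i.val
    rw [ZMod.natCast_zmod_val] at e1 e2
    exact ⟨by linear_combination e1 - e2, by linear_combination e1 + e2 - hrec' i⟩

/-- A rational potential is even if multiplication by it makes an odd eigenvector of the cycle
orthogonal to its discrete derivative. -/
lemma even_of_sum_mul_eq_zero (hL : 2 < L) {φ : ZMod L → ℝ} {c : ℝ}
    (hrec : ∀ i, φ (i + 1) + φ (i - 1) = c * φ i) (h0 : φ 0 = 0) (hφ : φ ≠ 0)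
    (q : ZMod L → ℚ) (hsum : ∑ i, (φ (i + 1) - φ (i - 1)) * (q i * φ i) = 0) (i : ZMod L) :
    q i = q (-i) := by
  have h1 : φ 1 ≠ 0 := fun h1 => hφ (eq_zero_of_cycle_recurrence hrec h0 h1)
  obtain ⟨z, hz, hzφ⟩ := exists_primitiveRoot_of_cycle_recurrence hrec h0 h1
  have h1' : (φ 1 : ℂ) ≠ 0 := by exact_mod_cast h1
  have hinv : ∀ i : ZMod L, z⁻¹ ^ i.val = z ^ (-i).val := by
    intro i
    have e := (AddChar.zmodChar L hz.pow_eq_one).map_neg_eq_inv i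
    simp only [AddChar.zmodChar_apply] at e
    rw [e, inv_pow]
  have hsumC : ∑ i, (φ (i + 1) - φ (i - 1) : ℂ) * (q i * φ i) = 0 := by exact_mod_cast hsum
  -- Sine times cosine is a sine of the double angle.
  have hA : ∑ i : ZMod L, (q i : ℂ) * ((z ^ i.val) ^ 2 - (z ^ (-i).val) ^ 2) = 0 := by
    apply mul_left_cancel₀ (mul_ne_zero h1' h1')
    rw [mul_zero, Finset.mul_sum, ← mul_zero (z - z⁻¹), ← hsumC, Finset.mul_sum]
    refine Finset.sum_congr rfl fun i _ => ?_
    rw [← hinv, (hzφ i).2]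
    linear_combination -(q i : ℂ) * φ 1 * (z ^ i.val + z⁻¹ ^ i.val) * (hzφ i).1
  have hB : ∑ i : ZMod L, (q i : ℂ) * (z ^ (-i).val) ^ 2 =
      ∑ i : ZMod L, (q (-i) : ℂ) * (z ^ i.val) ^ 2 := by
    rw [← Equiv.sum_comp (Equiv.neg (ZMod L))]
    simp
  have hz2 : IsPrimitiveRoot (z ^ 2) L := by
    apply hz.pow_of_coprime
    rw [Nat.coprime_comm, Nat.Prime.coprime_iff_not_dvd Fact.out]
    exact Nat.not_dvd_of_pos_of_lt two_pos hL
  have := hz2.eq_zero_of_sum_eq_zero (fun i => q i - q (-i)) (by simp) (by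
    simp only [mul_sub, Finset.sum_sub_distrib, hB] at hA
    rw [← hA, ← Finset.sum_sub_distrib]
    refine Finset.sum_congr rfl fun i _ => ?_
    push_cast
    rw [← pow_mul, ← pow_mul, mul_comm 2]
    ring)
  exact sub_eq_zero.mp (congrFun this i)

end FreeEigenvectors

/-! ### First-order perturbation at `t = 0` -/

section Perturbation

variable {L : ℕ} [Fact L.Prime]

/-- Pairing an eigenvector of `Δ + t V` with an eigenvector of `Δ`. -/
lemma sub_mul_sum_eq_of_eigen {v f φ : ZMod L → ℝ} {t μ lam : ℝ}
    (hf : ∀ i, 2 * f i - f (i + 1) - f (i - 1) = lam * f i)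
    (hφ : ∀ i, 2 * φ i - φ (i + 1) - φ (i - 1) + t * (v i * φ i) = μ * φ i) :
    (μ - lam) * ∑ i, f i * φ i = t * ∑ i, f i * (v i * φ i) := by
  have e1 : ∑ i, f i * φ (i + 1) = ∑ i, f (i - 1) * φ i := by
    rw [← Equiv.sum_comp (Equiv.addRight (1 : ZMod L)) (fun i => f (i - 1) * φ i)]
    simp
  have e2 : ∑ i, f i * φ (i - 1) = ∑ i, f (i + 1) * φ i := by
    rw [← Equiv.sum_comp (Equiv.subRight (1 : ZMod L)) (fun i => f (i + 1) * φ i)]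
    simp
  have e3 : ∑ i, f i * (2 * φ i - φ (i + 1) - φ (i - 1)) =
      ∑ i, (2 * f i - f (i + 1) - f (i - 1)) * φ i := by
    simp only [mul_sub, sub_mul, Finset.sum_sub_distrib, e1, e2]
    rw [sub_right_comm]
    congr 2
    exact Finset.sum_congr rfl fun i _ => by ring
  have e4 : ∑ i, f i * (2 * φ i - φ (i + 1) - φ (i - 1)) =
      μ * ∑ i, f i * φ i - t * ∑ i, f i * (v i * φ i) := by
    rw [Finset.mul_sum, Finset.mul_sum, ← Finset.sum_sub_distrib]
    exact Finset.sum_congr rfl fun i _ => by linear_combination f i * hφ i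
  have e5 : ∑ i, (2 * f i - f (i + 1) - f (i - 1)) * φ i = lam * ∑ i, f i * φ i := by
    rw [Finset.mul_sum]
    exact Finset.sum_congr rfl fun i _ => by linear_combination φ i * hf i
  linear_combination e3 - e4 + e5

/-- If eigenvectors of `Δ + t V` vanishing at `j` exist for arbitrarily small `t ≠ 0`, then some
eigenvector `φ` of `Δ` vanishing at `j` satisfies the first-order condition that `V φ` is orthogonal
to the discrete derivative of `φ`. -/
lemma exists_limit_eigenvector (hL : 2 < L) (v : ZMod L → ℝ) (j : ZMod L)
    (h : ∃ᶠ t in 𝓝[≠] (0 : ℝ), HasEigenvectorVanishingAt (hamiltonian L v t) j) :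
    ∃ (φ : ZMod L → ℝ) (c : ℝ), φ ≠ 0 ∧ φ j = 0 ∧
      (∀ i, φ (i + 1) + φ (i - 1) = c * φ i) ∧
      ∑ i, (φ (i + 1) - φ (i - 1)) * (v i * φ i) = 0 := by
  obtain ⟨t, ht, hvan⟩ := exists_seq_forall_of_frequently h
  rw [tendsto_nhdsWithin_iff] at ht
  obtain ⟨ht, hne⟩ := ht
  have hvan' : ∀ n, ∃ (μ : ℝ) (φ : ZMod L → ℝ), φ ∈ Metric.sphere (0 : ZMod L → ℝ) 1 ∧ φ j = 0 ∧
      ∀ i, 2 * φ i - φ (i + 1) - φ (i - 1) + t n * (v i * φ i) = μ * φ i := by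
    intro n
    obtain ⟨μ, φ, hφ, hj⟩ := hvan n
    rw [hasEigenvector_hamiltonian_iff hL] at hφ
    refine ⟨μ, ‖φ‖⁻¹ • φ, ?_, by simp [hj], fun i => ?_⟩
    · simp [norm_smul, hφ.1]
    · simp only [Pi.smul_apply, smul_eq_mul]
      linear_combination ‖φ‖⁻¹ * hφ.2 i
  choose μ φ hsph hj heig using hvan'
  obtain ⟨a, ha, s, hs, hlim⟩ := (isCompact_sphere (0 : ZMod L → ℝ) 1).tendsto_subseq hsph
  have hlim' : ∀ i, Tendsto (fun n => φ (s n) i) atTop (𝓝 (a i)) := tendsto_pi_nhds.mp hlim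
  have hts : Tendsto (fun n => t (s n)) atTop (𝓝 0) := ht.comp hs.tendsto_atTop
  have ha0 : a ≠ 0 := by rintro rfl; simp at ha
  have haj : a j = 0 := by
    refine tendsto_nhds_unique (hlim' j) ?_
    simp [hj]
  have hH : ∀ i, Tendsto (fun n => μ (s n) * φ (s n) i) atTop
      (𝓝 (2 * a i - a (i + 1) - a (i - 1))) := by
    intro i
    simp only [← heig]
    have := ((((hlim' i).const_mul 2).sub (hlim' (i + 1))).sub (hlim' (i - 1))).add
      (hts.mul ((hlim' i).const_mul (v i)))
    simpa using this
  obtain ⟨k, hk⟩ := Function.ne_iff.mp ha0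
  rw [Pi.zero_apply] at hk
  -- Cross-multiplying eliminates `μ`, so its convergence need not be proved.
  have hprop : ∀ i, (2 * a i - a (i + 1) - a (i - 1)) * a k =
      (2 * a k - a (k + 1) - a (k - 1)) * a i := by
    intro i
    refine tendsto_nhds_unique ((hH i).mul (hlim' k)) ?_
    refine ((hH k).mul (hlim' i)).congr fun n => ?_
    ring
  set lam := (2 * a k - a (k + 1) - a (k - 1)) / a k with hlam
  have hlap : ∀ i, 2 * a i - a (i + 1) - a (i - 1) = lam * a i := by
    intro i
    rw [hlam, div_mul_eq_mul_div, eq_div_iff hk]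
    exact hprop i
  have hrec : ∀ i, a (i + 1) + a (i - 1) = (2 - lam) * a i := by
    intro i
    linear_combination -hlap i
  refine ⟨a, 2 - lam, ha0, haj, hrec, ?_⟩
  set b : ZMod L → ℝ := fun i => a (i + 1) - a (i - 1) with hb
  have hblap : ∀ i, 2 * b i - b (i + 1) - b (i - 1) = lam * b i := by
    intro i
    have h1 := hlap (i + 1)
    have h2 := hlap (i - 1)
    simp only [hb, add_sub_cancel_right, sub_add_cancel] at h1 h2 ⊢
    linear_combination h1 - h2
  -- `a` and `b` share the eigenvalue `lam`: eliminate `μ - lam` between their two pairings and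
  -- cancel `t ≠ 0`.
  have hcross : ∀ᶠ n in atTop, (∑ i, b i * φ n i) * ∑ i, a i * (v i * φ n i) =
      (∑ i, a i * φ n i) * ∑ i, b i * (v i * φ n i) := by
    filter_upwards [hne] with n hn
    apply mul_left_cancel₀ hn
    have ea := sub_mul_sum_eq_of_eigen hlap (heig n)
    have eb := sub_mul_sum_eq_of_eigen hblap (heig n)
    linear_combination (∑ i, a i * φ n i) * eb - (∑ i, b i * φ n i) * ea
  have hsum1 : ∀ f : ZMod L → ℝ, Tendsto (fun n => ∑ i, f i * φ (s n) i) atTop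
      (𝓝 (∑ i, f i * a i)) := fun f =>
    tendsto_finsetSum _ fun i _ => (hlim' i).const_mul (f i)
  have hsum2 : ∀ f : ZMod L → ℝ, Tendsto (fun n => ∑ i, f i * (v i * φ (s n) i)) atTop
      (𝓝 (∑ i, f i * (v i * a i))) := fun f =>
    tendsto_finsetSum _ fun i _ => ((hlim' i).const_mul (v i)).const_mul (f i)
  have hlimcross : (∑ i, b i * a i) * ∑ i, a i * (v i * a i) =
      (∑ i, a i * a i) * ∑ i, b i * (v i * a i) :=
    tendsto_nhds_unique ((hsum1 b).mul (hsum2 a))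
      (((hsum1 a).mul (hsum2 b)).congr'
        ((hs.tendsto_atTop.eventually hcross).mono fun n hn => hn.symm))
  have horth : ∑ i, b i * a i = 0 := by
    simp only [hb, sub_mul, Finset.sum_sub_distrib]
    rw [sub_eq_zero, ← Equiv.sum_comp (Equiv.addRight (1 : ZMod L)) (fun i => a (i - 1) * a i)]
    simp [mul_comm]
  rw [horth, zero_mul, zero_eq_mul] at hlimcross
  refine hlimcross.resolve_left fun h0 => ha0 ?_
  rw [Finset.sum_eq_zero_iff_of_nonneg fun i _ => mul_self_nonneg _] at h0
  funext i
  exact mul_self_eq_zero.mp (h0 i (Finset.mem_univ i))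

/-- A rational potential is symmetric about every vertex at which eigenvectors of `Δ + t V` vanish
for arbitrarily small `t ≠ 0`. -/
lemma symmetric_of_frequently_vanishingAt (hL : 2 < L) (q : ZMod L → ℚ) (j : ZMod L)
    (h : ∃ᶠ t in 𝓝[≠] (0 : ℝ), HasEigenvectorVanishingAt (hamiltonian L (fun i => q i) t) j)
    (i : ZMod L) : q (j + i) = q (j - i) := by
  obtain ⟨φ, c, hφ, hj, hrec, hsum⟩ := exists_limit_eigenvector hL _ j h
  have := even_of_sum_mul_eq_zero hL (φ := fun i => φ (j + i)) (c := c) (fun i => ?_)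
    (by simpa using hj) (fun h0 => hφ (funext fun i => ?_)) (fun i => q (j + i)) ?_ i
  · rw [this, sub_eq_add_neg]
  · rw [← add_assoc, ← add_sub_assoc]
    exact hrec _
  · simpa using congrFun h0 (i - j)
  · rw [← Equiv.sum_comp (Equiv.addLeft j)] at hsum
    simpa [add_assoc, add_sub_assoc] using hsum

lemma hasReflectionSymmetry_of_isBadPotential (hL : 2 < L) (q : ZMod L → ℚ)
    (h : IsBadPotential L (fun i => q i)) : HasReflectionSymmetry L (fun i => (q i : ℝ)) := by
  by_contra hsymm
  have hev : ∀ j : ZMod L, ∀ᶠ t in 𝓝[≠] (0 : ℝ),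
      ¬ HasEigenvectorVanishingAt (hamiltonian L (fun i => q i) t) j := by
    intro j
    by_contra hfreq
    exact hsymm ⟨j, fun i =>
      congrArg _ (symmetric_of_frequently_vanishingAt hL q j hfreq i)⟩
  obtain ⟨t, ht⟩ := (eventually_all.mpr hev).exists
  refine h t ⟨?_, fun μ φ hφ j hj => ht j ⟨μ, φ, hφ, hj⟩⟩
  by_contra hdeg
  exact ht 0 (.of_not_hasSimpleEigenvalues hdeg 0)

lemma eq_of_forall_not_hasSimpleEigenvalues (hL : 2 < L) (q : ZMod L → ℚ)
    (h : ∀ t, ¬ HasSimpleEigenvalues (hamiltonian L (fun i => q i) t)) (i : ZMod L) :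
    q i = q 0 := by
  have h2 := ZMod.two_ne_zero_of_two_lt hL
  -- Reflection about `i / 2` exchanges `i` and `0`.
  have := symmetric_of_frequently_vanishingAt hL q (i / 2)
    (Frequently.of_forall fun t => .of_not_hasSimpleEigenvalues (h t) _) (i / 2)
  rwa [sub_self, ← add_div, ← two_mul, mul_div_cancel_left₀ _ h2] at this

end Perturbation

/-! ### Reflection symmetry implies badness -/

section Symmetric

variable {L : ℕ} [Fact L.Prime]

lemma isHermitian_hamiltonian (v : ZMod L → ℝ) (t : ℝ) : (hamiltonian L v t).IsHermitian := by
  refine (SimpleGraph.isHermitian_lapMatrix ℝ _).add ?_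
  rw [← Matrix.diagonal_smul]
  exact Matrix.isHermitian_diagonal _

/-- A subspace containing all eigenvectors of a real symmetric matrix is the whole space. -/
lemma Matrix.IsHermitian.eq_top_of_hasEigenvector_mem {n : Type*} [Fintype n] [DecidableEq n]
    {A : Matrix n n ℝ} (hA : A.IsHermitian) (W : Submodule ℝ (n → ℝ))
    (hW : ∀ μ φ, Module.End.HasEigenvector (Matrix.toLin' A) μ φ → φ ∈ W) : W = ⊤ := by
  let b := hA.eigenvectorBasis.toBasis.map (WithLp.linearEquiv 2 ℝ (n → ℝ))
  rw [eq_top_iff, ← b.span_eq, Submodule.span_le]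
  rintro _ ⟨i, rfl⟩
  refine hW (hA.eigenvalues i) _ ⟨?_, b.ne_zero i⟩
  rw [Module.End.mem_eigenspace_iff, Matrix.toLin'_apply]
  simpa [b] using hA.mulVec_eigenvectorBasis i

lemma isBadPotential_of_hasReflectionSymmetry (hL : 2 < L) (v : ZMod L → ℝ)
    (h : HasReflectionSymmetry L v) : IsBadPotential L v := by
  obtain ⟨j, hsymm⟩ := h
  rintro t ⟨-, hnv⟩
  let R : (ZMod L → ℝ) →ₗ[ℝ] (ZMod L → ℝ) := LinearMap.funLeft ℝ ℝ fun i => 2 * j - i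
  have hv : ∀ i, v (2 * j - i) = v i := by
    intro i
    have := hsymm (i - j)
    rw [add_sub_cancel, show j - (i - j) = 2 * j - i by ring] at this
    exact this.symm
  have htop : LinearMap.eqLocus R LinearMap.id = ⊤ := by
    refine (isHermitian_hamiltonian v t).eq_top_of_hasEigenvector_mem _ fun μ φ hφ => ?_
    by_contra hne
    rw [hasEigenvector_hamiltonian_iff hL] at hφ
    refine hnv μ (R φ - φ) ?_ j ?_
    · rw [hasEigenvector_hamiltonian_iff hL]
      refine ⟨fun h0 => hne (sub_eq_zero.mp h0), fun i => ?_⟩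
      have e1 := hφ.2 i
      have e2 := hφ.2 (2 * j - i)
      rw [hv, show 2 * j - i + 1 = 2 * j - (i - 1) by ring,
        show 2 * j - i - 1 = 2 * j - (i + 1) by ring] at e2
      simp only [R, Pi.sub_apply, LinearMap.funLeft_apply]
      linear_combination e2 - e1
    · simp [R, LinearMap.funLeft_apply, two_mul]
  -- The reflection sends `j + 1` to `j - 1 ≠ j + 1`, so this point mass is not even.
  have hmem : (Pi.single (j + 1) 1 : ZMod L → ℝ) ∈ LinearMap.eqLocus R LinearMap.id := by
    rw [htop]; trivial
  have := congrFun (LinearMap.mem_eqLocus.mp hmem) (j + 1)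
  have hne : 2 * j - (j + 1) ≠ j + 1 := by
    intro h
    apply ZMod.two_ne_zero_of_two_lt hL
    linear_combination -h
  simp [R, LinearMap.funLeft_apply, Pi.single_eq_of_ne hne] at this

end Symmetric

theorem proposition4p1 (L : ℕ) [Fact L.Prime] (hL : 2 < L)
    (v : ZMod L → ℝ) (hv : ∀ j, v j = 1 ∨ v j = -1) :
    (IsBadPotential L v ↔ HasReflectionSymmetry L v) ∧
    ((∀ t : ℝ, ¬ HasSimpleEigenvalues (hamiltonian L v t)) →
      (Matrix.diagonal v = 1 ∨ Matrix.diagonal v = -1)) ∧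
    ((∀ t : ℝ, ¬ HasNonvanishingEigenvectors (hamiltonian L v t)) →
      HasReflectionSymmetry L v) := by
  -- Of the values `±1`, the converse direction uses only rationality.
  obtain ⟨q, rfl⟩ : ∃ q : ZMod L → ℚ, v = fun i => (q i : ℝ) := by
    have : ∀ i, ∃ r : ℚ, v i = r := fun i =>
      (hv i).elim (fun h => ⟨1, by simp [h]⟩) fun h => ⟨-1, by simp [h]⟩
    choose q hq using this
    exact ⟨q, funext hq⟩
  refine ⟨⟨hasReflectionSymmetry_of_isBadPotential hL q,
    isBadPotential_of_hasReflectionSymmetry hL _⟩, fun h => ?_, fun h =>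
    hasReflectionSymmetry_of_isBadPotential hL q fun t ht => h t ht.2⟩
  have hconst := eq_of_forall_not_hasSimpleEigenvalues hL q h
  rw [← Matrix.diagonal_one, Matrix.diagonal_neg]
  refine (hv 0).imp (fun h0 => ?_) fun h0 => ?_ <;>
  · congr 1
    funext i
    simp only [hconst i, h0]
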